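/- Let $t\in(0,\infty)$ be fixed and, for $n\ge 1$, put $k=k_n=[t n^{2/3}]$ (integer part). A word of length $2k+1$ is a sequence $w=(w_0,w_1,\dots,w_{2k})$ of letters in $\{1,\dots,n\}$; its $j$-th step traverses the undirected edge $\{w_{j-1},w_j\}$, $1\le j\le 2k$ (loops $w_{j-1}=w_j$ are allowed). Let $\mathcal W_{2k}$ be the set of words of length $2k+1$ in which every edge that occurs is traversed exactly twice. Let $x=(x_{i,j})_{1\le i,j\le n}$ be a real symmetric random array such that the variables $(x_{i,j})_{i\le j}$ are independent and centered, the variables $(x_{i,j})_{i<j}$ are identically distributed with $\operatorname{Var}(x_{i,j})=\tfrac14$, the diagonal entries satisfy $\operatorname{Var}(x_{i,i})\le\tfrac12$, and, for some constant $K$, $\mathbb E[x_{i,j}^{2m}]\le (Km)^m$ for all $m\in\mathbb N$ and all $i,j$. For a word $w$ put $X_w=\prod_{j=1}^{2k}x_{w_{j-1},w_j}$. Then each $X_w$ with $w\in\mathcal W_{2k}$ is integrable and $$\frac1{n^{k}}\sum_{w\in\mathcal W_{2k}}\mathbb E[X_w]=O(1)\qquad\text{and}\qquad \#\mathcal W_{2k}=O\big(n^{k}2^{2k}\big)\qquad(n\to\infty),$$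 where the implied constants depend only on $t$. -/

import Mathlib

open MeasureTheory ProbabilityTheory

noncomputable section

/-- A word with `l + 1` letters (that is, `l` steps) over the alphabet `{1, …, n}`. -/
abbrev Word (n l : ℕ) : Type := Fin (l + 1) → Fin n

/-- The undirected edge traversed by the `i`-th step of a word (a loop when the two letters
agree). -/
def Word.edge {n l : ℕ} (w : Word n l) (i : Fin l) : Sym2 (Fin n) :=
  s(w i.castSucc, w i.succ)

/-- The number of steps at which the word traverses the edge `e`. -/
def Word.passages {n l : ℕ} (w : Word n l) (e : Sym2 (Fin n)) : ℕ :=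
  (Finset.univ.filter fun i : Fin l => w.edge i = e).card

/-- The words with `2 * k + 1` letters in `{1, …, n}` in which each edge of the graph of the word
is traversed exactly twice (such words are automatically closed). -/
def twiceWords (n k : ℕ) : Finset (Word n (2 * k)) :=
  Finset.univ.filter fun w => ∀ i, w.passages (w.edge i) = 2

/-- The random variable `X_w`, the product of the entries `x (w j) (w (j+1))` along the word. -/
def wordVar {Ω : Type*} {n l : ℕ} (x : Fin n → Fin n → Ω → ℝ) (w : Word n l) : Ω → ℝ :=
  fun ω => ∏ j : Fin l, x (w j.castSucc) (w j.succ) ω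

/-- The unnormalised entries `x i j` of a real symmetric Wigner matrix `(x i j / √n)`, scaled so
that the off-diagonal variance is `1 / 4`, with sub-Gaussian moments (constant `K`). The variance
on the diagonal is only required to be at most `1 / 2`, which allows both the value `1 / 4` and
the value `1 / 2` of the Gaussian orthogonal ensemble. -/
structure IsWigner {Ω : Type*} [MeasurableSpace Ω] (μ : Measure Ω) {n : ℕ}
    (x : Fin n → Fin n → Ω → ℝ) (K : ℝ) : Prop where
  measurable : ∀ i j, Measurable (x i j)
  symm : ∀ i j, x i j = x j i
  indep : iIndepFun (fun p : {p : Fin n × Fin n // p.1 ≤ p.2} => x p.1.1 p.1.2) μ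
  identDistrib : ∀ i j k l, i < j → k < l → IdentDistrib (x i j) (x k l) μ μ
  integrable_pow : ∀ i j (m : ℕ), Integrable (fun ω => x i j ω ^ (2 * m)) μ
  mean : ∀ i j, ∫ ω, x i j ω ∂μ = 0
  variance_offDiag : ∀ i j, i < j → variance (x i j) μ = 1 / 4
  variance_diag : ∀ i, variance (x i i) μ ≤ 1 / 2
  moment_le : ∀ i j (m : ℕ), ∫ ω, x i j ω ^ (2 * m) ∂μ ≤ (K * m) ^ m

/-- The power `k = [t n^{2/3}]`. -/
def edgePower (t : ℝ) (n : ℕ) : ℕ := ⌊t * (n : ℝ) ^ ((2 : ℝ) / 3)⌋₊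

end

/-! Since entries are independent, `E[X_w]` is a product of variances. It is at most `4^{-k}` times
the weight of `w`, which counts 2 for every loop step. Both claims thus follow from bounding the
total weight by `C n^k 4^k`, and for this it suffices that every edge is traversed an even number of
times.

Read such a word as a walk that opens and closes edges, with `O` the set of open ones. The number of
ways to close is controlled by a potential, the product over vertices of the odd factorials of their
open degrees. Summed over the closing steps, the potential does not increase. Summed over the
opening steps, it grows by at most `n + 5 (|O| + 1)`. So `walkSum_le` reduces the count to
nonnegative `±1` walks in `|O|` whose up steps carry these weights.

Typically `|O|` is of order `√k`, so the weights distort `n^k` by about `exp(C k^{3/2}/n) = O(1)`.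
Rigorously, `weightedBallot_le` compares with ballot numbers times a Gaussian-type factor, a
supersolution of the weighted recursion by `ballot_exp_step`. Finally the `n` starting points are
paid for by the decay `k^{-3/2}` of the Catalan number relative to `4^k` (`mul_ballot_le`). -/

/-! ### Ballot numbers and central binomial coefficients -/

/-- The number of `±1` walks of length `m` from `y` to `0`. -/
noncomputable def walkCount : ℕ → ℤ → ℝ
  | 0, y => if y = 0 then 1 else 0
  | m + 1, y => walkCount m (y + 1) + walkCount m (y - 1)

/-- The ballot numbers: for `y ≥ 1`, the number of `±1` walks of length `m` from `y` to `1` that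
stay positive. -/
noncomputable def ballot (m : ℕ) (y : ℤ) : ℝ := walkCount m (y - 1) - walkCount m (y + 1)

lemma walkCount_nonneg (m : ℕ) (y : ℤ) : 0 ≤ walkCount m y := by
  induction m generalizing y with
  | zero => rw [walkCount]; split_ifs <;> norm_num
  | succ m ih => rw [walkCount]; exact add_nonneg (ih _) (ih _)

lemma walkCount_eq_zero {m : ℕ} {y : ℤ} (h : (m : ℤ) < y) : walkCount m y = 0 := by
  induction m generalizing y with
  | zero => rw [walkCount, if_neg (by push_cast at h; omega)]
  | succ m ih =>
    push_cast at h
    rw [walkCount, ih (by omega), ih (by omega), add_zero]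

lemma walkCount_eq_choose (m j : ℕ) : walkCount m (m - 2 * j) = m.choose j := by
  induction m generalizing j with
  | zero =>
    rcases j with _ | j
    · simp [walkCount]
    · rw [walkCount, if_neg (by push_cast; omega)]; simp
  | succ m ih =>
    have h2 := ih j
    rcases j with _ | j
    · rw [walkCount, walkCount_eq_zero (by push_cast; omega)]
      have : ((m + 1 : ℕ) : ℤ) - 2 * (0 : ℕ) - 1 = m - 2 * (0 : ℕ) := by push_cast; ring
      rw [this, h2]; simp
    · have h1 := ih j
      rw [walkCount]
      have e1 : ((m + 1 : ℕ) : ℤ) - 2 * (j + 1 : ℕ) + 1 = m - 2 * j := by push_cast; ring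
      have e2 : ((m + 1 : ℕ) : ℤ) - 2 * (j + 1 : ℕ) - 1 = m - 2 * (j + 1 : ℕ) := by
        push_cast; ring
      rw [e1, e2, h1, h2, Nat.choose_succ_succ]; push_cast; ring

/-- The hitting time theorem: `ballot m y` counts walks from `y` that first reach 0 at time `m + 1`.
The induction combines the recursions of both sides. -/
lemma succ_mul_ballot (m : ℕ) (y : ℤ) :
    ((m : ℝ) + 1) * ballot m y = y * walkCount (m + 1) y := by
  induction m generalizing y with
  | zero =>
    simp only [ballot, walkCount]
    by_cases h1 : y = 1
    · subst h1; norm_num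
    · by_cases h2 : y = -1
      · subst h2; norm_num
      · rw [if_neg (by omega), if_neg (by omega)]; simp
  | succ m ih =>
    have h1 := ih (y - 1)
    have h2 := ih (y + 1)
    have e : ballot (m + 1) y = ballot m (y + 1) + ballot m (y - 1) := by
      simp only [ballot, walkCount]; ring_nf
    have e3 : walkCount (m + 1 + 1) y = walkCount (m + 1) (y + 1) + walkCount (m + 1) (y - 1) :=
      rfl
    have e4 : ballot (m + 1) y = walkCount (m + 1) (y - 1) - walkCount (m + 1) (y + 1) := rfl
    push_cast at *
    rw [e3]
    linear_combination ((m : ℝ) + 1) * e + h1 + h2 + e4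

lemma ballot_succ (m : ℕ) (y : ℤ) : ballot (m + 1) y = ballot m (y + 1) + ballot m (y - 1) := by
  simp only [ballot, walkCount]; ring_nf

/-- The drift of the walk conditioned to stay positive until the end: a repulsion of order `1 / y`
from 0 and a bridge-like pull back of order `y / m`. -/
lemma ballot_drift (m : ℕ) (y : ℤ) :
    ((m : ℝ) + 1) * (y * (ballot m (y + 1) - ballot m (y - 1))) =
      (m + 2 - (y : ℝ) ^ 2) * ballot (m + 1) y := by
  have h1 := succ_mul_ballot m (y - 1)
  have h2 := succ_mul_ballot m (y + 1)
  have h3 := succ_mul_ballot (m + 1) y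
  have e3 : walkCount (m + 1 + 1) y = walkCount (m + 1) (y + 1) + walkCount (m + 1) (y - 1) := rfl
  have e4 : ballot (m + 1) y = walkCount (m + 1) (y - 1) - walkCount (m + 1) (y + 1) := rfl
  rw [e3] at h3
  push_cast at *
  linear_combination (y : ℝ) * h2 - y * h1 - h3 + (y : ℝ) ^ 2 * e4

lemma ballot_zero_right (m : ℕ) : ballot m 0 = 0 := by
  have h := succ_mul_ballot m 0
  have : ((m : ℝ) + 1) ≠ 0 := by positivity
  simpa [this] using h

lemma ballot_nonneg (m : ℕ) {y : ℤ} (hy : 0 ≤ y) : 0 ≤ ballot m y := by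
  have h := succ_mul_ballot m y
  have hy' : (0 : ℝ) ≤ y := by exact_mod_cast hy
  have : 0 ≤ ((m : ℝ) + 1) * ballot m y := h ▸ mul_nonneg hy' (walkCount_nonneg _ _)
  exact nonneg_of_mul_nonneg_right this (by positivity)

lemma ballot_eq_zero {m : ℕ} {y : ℤ} (h : (m : ℤ) + 1 < y) : ballot m y = 0 := by
  rw [ballot, walkCount_eq_zero (by omega), walkCount_eq_zero (by omega), sub_zero]

lemma ballot_one_le (k : ℕ) : (2 * (k : ℝ) + 1) * ballot (2 * k) 1 ≤ 2 * k.centralBinom := by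
  have h := succ_mul_ballot (2 * k) 1
  have e1 : walkCount (2 * k) (1 - 1) = k.centralBinom := by
    have := walkCount_eq_choose (2 * k) k
    rw [Nat.centralBinom_eq_two_mul_choose, ← this]; congr 1; push_cast; ring
  have e2 : walkCount (2 * k) (1 + 1) ≤ walkCount (2 * k) (1 - 1) := by
    have := ballot_nonneg (2 * k) (y := 1) (by norm_num)
    rw [ballot] at this; linarith
  have e3 : walkCount (2 * k + 1) 1 = walkCount (2 * k) (1 + 1) + walkCount (2 * k) (1 - 1) := rfl
  rw [e3, Int.cast_one, one_mul, Nat.cast_mul, Nat.cast_two] at h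
  rw [h]; linarith

/-- Induction on the ratio of consecutive terms, using `(2k+1)(2k+3) ≤ 4(k+1)²`. -/
lemma centralBinom_sq_le (k : ℕ) : (2 * (k : ℝ) + 1) * (k.centralBinom : ℝ) ^ 2 ≤ 16 ^ k := by
  induction k with
  | zero => simp
  | succ k ih =>
    have h : ((k : ℝ) + 1) * (k + 1).centralBinom = 2 * (2 * k + 1) * k.centralBinom := by
      exact_mod_cast Nat.succ_mul_centralBinom_succ k
    have hk : (0 : ℝ) < ((k : ℝ) + 1) ^ 2 := by positivity
    refine le_of_mul_le_mul_left ?_ hk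
    have e : ((k : ℝ) + 1) ^ 2 * ((2 * ((k + 1 : ℕ) : ℝ) + 1) * ((k + 1).centralBinom : ℝ) ^ 2) =
        4 * ((2 * (k : ℝ) + 3) * (2 * k + 1)) * ((2 * k + 1) * (k.centralBinom : ℝ) ^ 2) := by
      push_cast
      linear_combination (2 * (k : ℝ) + 3) * (((k : ℝ) + 1) * (k + 1).centralBinom +
        2 * (2 * k + 1) * k.centralBinom) * h
    rw [e, pow_succ]
    calc _ ≤ 4 * (4 * ((k : ℝ) + 1) ^ 2) * 16 ^ k := by
          refine mul_le_mul ?_ ih (by positivity) (by positivity)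
          nlinarith
      _ = _ := by ring

/-! ### Comparison of weighted and unweighted ballot numbers -/

/-- Second order bounds for the exponential on the range of parameters of `ballot_exp_step`. -/
lemma exp_le_of_small {k q z : ℝ} (hk : 1 ≤ k) (hq : 0 ≤ q) (hqk : q + 1 ≤ 2 * k) (hz : 1 ≤ z)
    (hzq : z ≤ q + 2) {a : ℝ} (ha0 : 0 < a) (hak : a * k ^ 2 = 1 / 150) {σ : ℝ}
    (hσ : σ = 1 ∨ σ = -1) :
    Real.exp (σ * (2 * (a * (q * z))) + a * q - a * z ^ 2) ≤
        1 + (σ * (2 * (a * (q * z))) + a * q - a * z ^ 2) + (a * z ^ 2 / 2 + a) ∧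
      Real.exp (σ * (2 * (a * (q * z))) + a * q - a * z ^ 2) ≤ 3 := by
  have hz3 : z ≤ 3 * k := by linarith
  have haq : a * q ^ 2 ≤ 4 / 150 := by
    calc a * q ^ 2 ≤ a * (2 * k) ^ 2 := by gcongr; linarith
      _ = 4 / 150 := by rw [mul_pow]; linarith
  have haz : a * z ^ 2 ≤ 9 / 150 := by
    calc a * z ^ 2 ≤ a * (3 * k) ^ 2 := by gcongr
      _ = 9 / 150 := by rw [mul_pow]; linarith
  have haqz : a * (q * z) ≤ 6 / 150 := by
    calc a * (q * z) ≤ a * (2 * k * (3 * k)) := by gcongr; linarith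
      _ = 6 / 150 := by linarith
  have haqq : a * q ≤ 2 / 150 := by
    have hkk : k ≤ k ^ 2 := by nlinarith
    calc a * q ≤ a * (2 * k ^ 2) := by gcongr; linarith
      _ = 2 / 150 := by linarith
  have hq0 : 0 ≤ a * q := by positivity
  have hz0 : 0 ≤ a * z ^ 2 := by positivity
  have hqz0 : 0 ≤ a * (q * z) := by positivity
  -- The constant 150 is chosen here: the coefficient of `a z²` is `3 (4·4 + 9) / 150 = 1/2`.
  have hX' : 3 * ((2 * (a * (q * z))) ^ 2 + (a * q) ^ 2 + (a * z ^ 2) ^ 2) ≤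
      a * z ^ 2 / 2 + a := by
    have e1 : (a * (q * z)) ^ 2 = (a * q ^ 2) * (a * z ^ 2) := by ring
    have e2 : (a * q) ^ 2 = (a * q ^ 2) * a := by ring
    have e3 : (a * z ^ 2) ^ 2 = (a * z ^ 2) * (a * z ^ 2) := by ring
    have i1 : (a * q ^ 2) * (a * z ^ 2) ≤ 4 / 150 * (a * z ^ 2) :=
      mul_le_mul_of_nonneg_right haq hz0
    have i2 : (a * q ^ 2) * a ≤ 4 / 150 * a := mul_le_mul_of_nonneg_right haq ha0.le
    have i3 : (a * z ^ 2) * (a * z ^ 2) ≤ 9 / 150 * (a * z ^ 2) :=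
      mul_le_mul_of_nonneg_right haz hz0
    rw [mul_pow 2, e1, e2, e3]
    linarith
  have hsq : ∀ u v w : ℝ, (σ * u + v - w) ^ 2 ≤ 3 * (u ^ 2 + v ^ 2 + w ^ 2) := by
    intro u v w
    have hσ2 : (σ * u) ^ 2 = u ^ 2 := by rcases hσ with rfl | rfl <;> ring
    rw [← hσ2]
    nlinarith [sq_nonneg (σ * u - v), sq_nonneg (σ * u + w), sq_nonneg (v + w)]
  have hx2 := (hsq (2 * (a * (q * z))) (a * q) (a * z ^ 2)).trans hX'
  have hx1 : |σ * (2 * (a * (q * z))) + a * q - a * z ^ 2| ≤ 1 := by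
    rcases hσ with rfl | rfl <;> exact abs_le.2 ⟨by linarith, by linarith⟩
  constructor
  · have := (abs_le.1 (Real.abs_exp_sub_one_sub_id_le hx1)).2
    linarith
  · calc _ ≤ Real.exp 1 := Real.exp_le_exp.2 (abs_le.1 hx1).2
      _ ≤ 3 := by have := Real.exp_one_lt_d9; linarith

/-- One step of the comparison of weighted with unweighted ballot numbers. -/
lemma ballot_exp_step {t n k : ℝ} {m : ℕ} {y : ℤ} (hn : 1 ≤ n) (hk : 1 ≤ k)
    (ht : k ^ 3 ≤ t ^ 3 * n ^ 2) (hm : (m : ℝ) + 1 ≤ 2 * k) (hy : 1 ≤ y) :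
    (1 + 5 * y / n) * (ballot m (y + 1) * Real.exp (1 / (150 * k ^ 2) * m * (y + 1 : ℝ) ^ 2)) +
        ballot m (y - 1) * Real.exp (1 / (150 * k ^ 2) * m * (y - 1 : ℝ) ^ 2) ≤
      ballot (m + 1) y *
        Real.exp (1 / (150 * k ^ 2) * (m + 1) * (y : ℝ) ^ 2 + (1 + 16875 * t ^ 3) / k) := by
  -- Above `m + 2` all three ballot numbers vanish; below it the exponents are small enough to
  -- expand.
  rcases lt_or_ge ((m : ℤ) + 2) y with hlt | hle
  · rw [ballot_eq_zero (by omega), ballot_eq_zero (by omega), ballot_eq_zero (by push_cast; omega)]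
    simp
  have hy1 : (1 : ℝ) ≤ y := by exact_mod_cast hy
  have hym : (y : ℝ) ≤ m + 2 := by exact_mod_cast hle
  have hm0 : (0 : ℝ) ≤ m := Nat.cast_nonneg m
  have hP := ballot_nonneg m (y := y + 1) (by omega)
  have hM := ballot_nonneg m (y := y - 1) (by omega)
  have hD := ballot_drift m y
  have hS := ballot_succ m y
  set P := ballot m (y + 1)
  set M := ballot m (y - 1)
  rw [hS] at hD ⊢
  set a := 1 / (150 * k ^ 2) with ha
  set b := (1 + 16875 * t ^ 3) / k with hb
  set z : ℝ := (y : ℝ)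
  set q : ℝ := (m : ℝ)
  have ha0 : 0 < a := by positivity
  have hak : a * k ^ 2 = 1 / 150 := by rw [ha]; field_simp
  obtain ⟨hp, hp3⟩ := exp_le_of_small hk hm0 hm hy1 hym ha0 hak (Or.inl rfl)
  obtain ⟨hmm, -⟩ := exp_le_of_small hk hm0 hm hy1 hym ha0 hak (Or.inr rfl)
  rw [one_mul] at hp hp3
  rw [neg_one_mul] at hmm
  set X := a * z ^ 2 / 2 + a with hX
  set xp := 2 * (a * (q * z)) + a * q - a * z ^ 2 with hxp
  set xm := -(2 * (a * (q * z))) + a * q - a * z ^ 2 with hxm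
  -- the drift term
  have hdrift : 2 * (a * (q * z)) * (P - M) ≤ 2 * a * (q + 1) * (P + M) := by
    have hq1 : (0 : ℝ) < q + 1 := by positivity
    refine le_of_mul_le_mul_left ?_ hq1
    calc (q + 1) * (2 * (a * (q * z)) * (P - M))
        = 2 * a * q * ((q + 1) * (z * (P - M))) := by ring
      _ = (2 * a) * ((q * (q + 2) - q * z ^ 2) * (P + M)) := by rw [hD]; ring
      _ ≤ (2 * a) * ((q + 1) ^ 2 * (P + M)) := by
          have : 0 ≤ q * z ^ 2 := by positivity
          gcongr
          linarith [(by ring : (q + 1) ^ 2 = q * (q + 2) + 1)]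
      _ = _ := by ring
  -- absorbing the weight
  have hw : 15 * z / n ≤ a * z ^ 2 / 2 + 16875 * t ^ 3 / k := by
    have h1 : 15 * z / n ≤ a * z ^ 2 / 2 + 225 / (2 * a * n ^ 2) := by
      have : 0 ≤ (a * z - 15 / n) ^ 2 / (2 * a) := by positivity
      have e : (a * z - 15 / n) ^ 2 / (2 * a) =
          a * z ^ 2 / 2 + 225 / (2 * a * n ^ 2) - 15 * z / n := by
        field_simp; ring
      linarith
    have h2 : 225 / (2 * a * n ^ 2) ≤ 16875 * t ^ 3 / k := by
      rw [ha, div_le_div_iff₀ (by positivity) (by positivity)]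
      have : 16875 * t ^ 3 * (2 * (1 / (150 * k ^ 2)) * n ^ 2) =
        225 * (t ^ 3 * n ^ 2) / k ^ 2 := by field_simp; ring
      rw [this, le_div_iff₀ (by positivity)]
      nlinarith
    linarith
  have hrest : 2 * a * (q + 1) + a * q + a ≤ 1 / k := by
    rw [le_div_iff₀ (by positivity)]
    calc (2 * a * (q + 1) + a * q + a) * k ≤ (2 * a * (2 * k) + a * (2 * k) + a * k) * k := by
          have := mul_le_mul_of_nonneg_left hk ha0.le
          gcongr <;> linarith
      _ = 7 * (a * k ^ 2) := by ring
      _ ≤ 1 := by rw [hak]; norm_num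
  have hb' : b = 1 / k + 16875 * t ^ 3 / k := by rw [hb]; ring
  have hz5 : 0 ≤ 5 * z / n := by positivity
  -- Half of the gain `-a z²` pays for the second order error, the other half for the weight `15 z /
  -- n = 3 · 5 z / n`, where 3 bounds `exp xp`.
  have key : (1 + 5 * z / n) * (P * Real.exp xp) + M * Real.exp xm ≤ (P + M) * Real.exp b := by
    calc (1 + 5 * z / n) * (P * Real.exp xp) + M * Real.exp xm
        = P * Real.exp xp + M * Real.exp xm + 5 * z / n * (P * Real.exp xp) := by ring
      _ ≤ P * (1 + xp + X) + M * (1 + xm + X) + 5 * z / n * ((P + M) * 3) := by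
          gcongr; linarith
      _ = (P + M) * (1 + a * q - a * z ^ 2 + X + 15 * z / n) + 2 * (a * (q * z)) * (P - M) := by
          rw [hxp, hxm]; ring
      _ ≤ (P + M) * (1 + a * q - a * z ^ 2 + X + 15 * z / n) + 2 * a * (q + 1) * (P + M) := by
          gcongr
      _ = (P + M) * (1 + a * q - a * z ^ 2 + X + 15 * z / n + 2 * a * (q + 1)) := by ring
      _ ≤ (P + M) * Real.exp b := by
          gcongr
          have := Real.add_one_le_exp b
          rw [hX]; linarith
  have e1 : Real.exp (a * q * (z + 1) ^ 2) =
      Real.exp xp * Real.exp (a * (q + 1) * z ^ 2) := by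
    rw [← Real.exp_add]; congr 1; rw [hxp]; ring
  have e2 : Real.exp (a * q * (z - 1) ^ 2) =
      Real.exp xm * Real.exp (a * (q + 1) * z ^ 2) := by
    rw [← Real.exp_add]; congr 1; rw [hxm]; ring
  rw [e1, e2, Real.exp_add]
  have := mul_le_mul_of_nonneg_right key (Real.exp_pos (a * (q + 1) * z ^ 2)).le
  linarith

/-- The sum over nonnegative `±1` walks of length `m` from `s` to `0` of the product over the up
steps, from `j` to `j + 1`, of the weights `n + 5 * (j + 1)`. -/
noncomputable def weightedBallot (n : ℝ) : ℕ → ℕ → ℝ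
  | 0, s => if s = 0 then 1 else 0
  | m + 1, 0 => (n + 5) * weightedBallot n m 1
  | m + 1, s + 1 => (n + 5 * (s + 2)) * weightedBallot n m (s + 2) + weightedBallot n m s

lemma weightedBallot_nonneg {n : ℝ} (hn : 0 ≤ n) (m s : ℕ) : 0 ≤ weightedBallot n m s := by
  induction m generalizing s with
  | zero => rw [weightedBallot]; split_ifs <;> norm_num
  | succ m ih =>
    rcases s with _ | s
    · rw [weightedBallot]; exact mul_nonneg (by positivity) (ih _)
    · rw [weightedBallot]; exact add_nonneg (mul_nonneg (by positivity) (ih _)) (ih _)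

/-- With `r = √n`, the powers of `r` extract a factor `n` from each of the `(m - s) / 2` up steps.
The shift `y = s + 1` turns nonnegative walks into positive ones. -/
lemma weightedBallot_le {t r : ℝ} {k : ℕ} (hr : 1 ≤ r) (ht : (k : ℝ) ^ 3 ≤ t ^ 3 * (r ^ 2) ^ 2)
    (m s : ℕ) (hm : m ≤ 2 * k) :
    r ^ s * weightedBallot (r ^ 2) m s ≤ r ^ m * (ballot m (s + 1) *
      Real.exp (1 / (150 * (k : ℝ) ^ 2) * m * ((s : ℝ) + 1) ^ 2 +
        (1 + 16875 * t ^ 3) / k * m)) := by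
  have hr0 : 0 < r := by linarith
  induction m generalizing s with
  | zero =>
    rw [weightedBallot]
    rcases s with _ | s
    · simp [ballot, walkCount]
    · rw [if_neg (by omega)]
      have := ballot_nonneg 0 (y := ((s + 1 : ℕ) : ℤ) + 1) (by positivity)
      rw [mul_zero]; positivity
  | succ m ih =>
    have hk : (1 : ℝ) ≤ k := by exact_mod_cast (by omega : 1 ≤ k)
    have hm' : (m : ℝ) + 1 ≤ 2 * k := by exact_mod_cast hm
    have hr2 : (1 : ℝ) ≤ r ^ 2 := one_le_pow₀ hr
    have step := ballot_exp_step (t := t) (m := m) (y := s + 1) hr2 hk ht hm' (by omega)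
    set b := (1 + 16875 * t ^ 3) / (k : ℝ)
    set a := 1 / (150 * (k : ℝ) ^ 2)
    have up := ih (s + 1) (by omega)
    have step' := mul_le_mul_of_nonneg_left step
      (mul_nonneg (pow_nonneg hr0.le (m + 1)) (Real.exp_pos (b * m)).le)
    have eR : Real.exp (a * ((m + 1 : ℕ) : ℝ) * ((s : ℝ) + 1) ^ 2 + b * ((m + 1 : ℕ) : ℝ)) =
        Real.exp (b * m) * Real.exp (a * ((m : ℝ) + 1) * ((s : ℝ) + 1) ^ 2 + b) := by
      rw [← Real.exp_add]; congr 1; push_cast; ring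
    rw [eR]
    push_cast at step' up ⊢
    rw [Real.exp_add] at up
    have hup := mul_le_mul_of_nonneg_left up
      (by positivity : (0 : ℝ) ≤ (1 + 5 * ((s : ℝ) + 1) / r ^ 2) * r)
    have e : (1 + 5 * ((s : ℝ) + 1) / r ^ 2) * r * (r ^ (s + 1) * weightedBallot (r ^ 2) m (s + 1))
        = r ^ s * ((r ^ 2 + 5 * (s + 1)) * weightedBallot (r ^ 2) m (s + 1)) := by
      field_simp; ring
    rw [e] at hup
    rcases s with _ | s
    -- No down step exists at height 0, matching `ballot m 0 = 0`.
    · simp only [Nat.cast_zero, zero_add, sub_self, ballot_zero_right, zero_mul, add_zero] at *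
      rw [weightedBallot]
      simp only [mul_one] at *
      refine hup.trans (le_trans (le_of_eq ?_) (step'.trans (le_of_eq ?_))) <;> ring_nf
    · have down := ih s (by omega)
      rw [Real.exp_add] at down
      have hdown := mul_le_mul_of_nonneg_left down hr0.le
      rw [weightedBallot]
      push_cast at *
      have e5 : (s : ℝ) + 1 + 1 - 1 = s + 1 := by ring
      have e6 : (s : ℤ) + 1 + 1 - 1 = s + 1 := by ring
      rw [e5, e6] at step'
      have e7 : (s : ℝ) + 1 + 1 = s + 2 := by ring
      rw [e7] at *
      refine le_trans (le_of_eq ?_) ((add_le_add hup hdown).trans (le_trans (le_of_eq ?_)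
        (step'.trans (le_of_eq ?_)))) <;> ring_nf

/-! ### The pairing potential and the walk of open edges -/

section StateSum

variable {V : Type*} [DecidableEq V]

/-- The number of half-edges of `e` at the vertex `a`; a loop at `a` has two of them. -/
def halfEdges (a : V) : Sym2 V → ℕ :=
  Sym2.lift ⟨fun x y => (if x = a then 1 else 0) + (if y = a then 1 else 0),
    fun _ _ => add_comm _ _⟩

@[simp] lemma halfEdges_mk (a x y : V) :
    halfEdges a s(x, y) = (if x = a then 1 else 0) + (if y = a then 1 else 0) := rfl

/-- The degree of `a` in the graph with edges `O`, with one additional half-edge at the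
origin `o`. -/
def rootedDegree (o : V) (O : Finset (Sym2 V)) (a : V) : ℕ :=
  ∑ e ∈ O, halfEdges a e + if a = o then 1 else 0

/-- The weight of a step: `2` for a loop, and `1` otherwise. -/
noncomputable def stepWeight (v u : V) : ℝ := if v = u then 2 else 1

lemma stepWeight_nonneg (v u : V) : 0 ≤ stepWeight v u := by
  rw [stepWeight]; split_ifs <;> norm_num

lemma one_le_stepWeight (v u : V) : 1 ≤ stepWeight v u := by
  rw [stepWeight]; split_ifs <;> norm_num

/-- The product of the odd numbers up to `d`. -/
def oddFactorial : ℕ → ℕ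
  | 0 => 1
  | d + 1 => if Even d then (d + 1) * oddFactorial d else oddFactorial d

/-- Flip the membership of `e` in `O`. -/
def toggle (O : Finset (Sym2 V)) (e : Sym2 V) : Finset (Sym2 V) :=
  if e ∈ O then O.erase e else insert e O

/-- A walker at `v` whose edges traversed an odd number of times so far are `O` has, apart from
the origin `o`, odd degree at `v` and even degree everywhere else. -/
def IsParityState (o v : V) (O : Finset (Sym2 V)) : Prop :=
  ∀ a, Even (rootedDegree o O a + if a = v then 1 else 0)

lemma rootedDegree_insert {O : Finset (Sym2 V)} {v u : V} (h : s(v, u) ∉ O) (o a : V) :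
    rootedDegree o (insert s(v, u) O) a =
      rootedDegree o O a + (if v = a then 1 else 0) + (if u = a then 1 else 0) := by
  rw [rootedDegree, rootedDegree, Finset.sum_insert h, halfEdges_mk]; ring

lemma IsParityState.insert {o v u : V} {O : Finset (Sym2 V)} (h : IsParityState o v O)
    (he : s(v, u) ∉ O) : IsParityState o u (insert s(v, u) O) := by
  intro a
  have := h a
  rw [rootedDegree_insert he]
  simp only [eq_comm (a := a)] at *
  split_ifs at * <;> simp_all [Nat.even_add_one, parity_simps]

lemma IsParityState.erase {o v u : V} {O : Finset (Sym2 V)} (h : IsParityState o v O)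
    (he : s(v, u) ∈ O) : IsParityState o u (O.erase s(v, u)) := by
  intro a
  have := h a
  have e := rootedDegree_insert (Finset.notMem_erase s(v, u) O) o a
  rw [Finset.insert_erase he] at e
  rw [e] at this
  simp only [eq_comm (a := a)] at *
  split_ifs at * <;> simp_all [Nat.even_add_one, parity_simps]

lemma IsParityState.toggle {o v : V} {O : Finset (Sym2 V)} (h : IsParityState o v O) (u : V) :
    IsParityState o u (toggle O s(v, u)) := by
  rw [_root_.toggle]; split_ifs with he
  exacts [h.erase he, h.insert he]

variable [Fintype V]

lemma sum_rootedDegree (o : V) (O : Finset (Sym2 V)) :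
    ∑ a, rootedDegree o O a = 2 * O.card + 1 := by
  have h : ∀ e : Sym2 V, ∑ a, halfEdges a e = 2 := by
    intro e
    induction e with
    | _ x y => simp [Finset.sum_add_distrib]
  simp only [rootedDegree, Finset.sum_add_distrib]
  rw [Finset.sum_comm]
  simp [h, mul_comm]

/-- The product over the vertices of the odd factorials of their degrees. It bounds the ambiguity
in closing the open edges `O`: see `sum_pairingPotential_erase_le`. -/
def pairingPotential (o : V) (O : Finset (Sym2 V)) : ℕ := ∏ a, oddFactorial (rootedDegree o O a)

lemma pairingPotential_empty (o : V) : pairingPotential o (∅ : Finset (Sym2 V)) = 1 := by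
  refine Finset.prod_eq_one fun a _ => ?_
  simp only [rootedDegree, Finset.sum_empty, zero_add]
  split_ifs <;> simp [oddFactorial]

/-- The root half-edge makes the degree odd exactly at the walker, even when it is at the origin.
Leaving `v` makes its degree even, which costs nothing; arriving at `u` makes its degree odd and
contributes that degree as a new factor. -/
lemma pairingPotential_insert {o v u : V} {O : Finset (Sym2 V)} (h : IsParityState o v O)
    (he : s(v, u) ∉ O) :
    pairingPotential o (insert s(v, u) O) =
      rootedDegree o (insert s(v, u) O) u * pairingPotential o O := by
  have key : ∀ a, oddFactorial (rootedDegree o (insert s(v, u) O) a) =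
      (if u = a then rootedDegree o (insert s(v, u) O) u else 1) *
        oddFactorial (rootedDegree o O a) := by
    intro a
    have hp := h a
    by_cases hu : u = a
    · subst hu
      rw [rootedDegree_insert he, if_pos rfl, if_pos rfl]
      by_cases hv : v = u
      · subst hv
        simp only [if_true] at *
        have hodd : ¬ Even (rootedDegree o O v) := Nat.even_add_one.1 hp
        rw [oddFactorial, if_pos hp, oddFactorial, if_neg hodd]
      · rw [if_neg (Ne.symm hv), add_zero] at hp
        rw [if_neg hv, add_zero, oddFactorial, if_pos hp]
    · rw [rootedDegree_insert he, if_neg hu, if_neg hu, add_zero, one_mul]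
      by_cases hv : v = a
      · subst hv
        simp only [if_true] at *
        rw [oddFactorial, if_neg (Nat.even_add_one.1 hp)]
      · rw [if_neg hv, add_zero]
  simp only [pairingPotential, key, Finset.prod_mul_distrib]
  simp

/-- The weighted number of walks of length `m` from `v` which traverse an odd number of times
exactly the edges in `O`. -/
noncomputable def walkSum : ℕ → V → Finset (Sym2 V) → ℝ
  | 0, _, O => if O = ∅ then 1 else 0
  | m + 1, v, O => ∑ u, stepWeight v u * walkSum m u (toggle O s(v, u))

/-- Opening one more edge at `v`. -/
lemma sum_pairingPotential_insert_le {o v : V} {O : Finset (Sym2 V)} (h : IsParityState o v O) :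
    ∑ u with s(v, u) ∉ O, stepWeight v u * (pairingPotential o (insert s(v, u) O) : ℝ) ≤
      (Fintype.card V + 5 * (O.card + 1)) * pairingPotential o O := by
  -- For a loop, `2 (d + 2) = (d + 1) + (d + 3)`, so the surplus `d + 3` occurs only at `u = v`.
  have h1 : ∀ u, s(v, u) ∉ O → stepWeight v u * (pairingPotential o (insert s(v, u) O) : ℝ) =
      ((rootedDegree o O u + 1) + if v = u then (rootedDegree o O u + 3 : ℝ) else 0) *
        pairingPotential o O := by
    intro u hu
    rw [pairingPotential_insert h hu, rootedDegree_insert hu, stepWeight, if_pos rfl]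
    split_ifs <;> push_cast <;> ring
  calc ∑ u with s(v, u) ∉ O, stepWeight v u * (pairingPotential o (insert s(v, u) O) : ℝ)
      = ∑ u with s(v, u) ∉ O,
          ((rootedDegree o O u + 1) + if v = u then (rootedDegree o O u + 3 : ℝ) else 0) *
            pairingPotential o O :=
        Finset.sum_congr rfl fun u hu => h1 u (Finset.mem_filter.1 hu).2
    _ ≤ ∑ u, ((rootedDegree o O u + 1) + if v = u then (rootedDegree o O u + 3 : ℝ) else 0) *
          pairingPotential o O :=
        Finset.sum_le_sum_of_subset_of_nonneg (Finset.filter_subset _ _)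
          fun u _ _ => by positivity
    _ = ((∑ u, rootedDegree o O u : ℕ) + Fintype.card V + (rootedDegree o O v + 3)) *
          pairingPotential o O := by
        rw [← Finset.sum_mul, Finset.sum_add_distrib, Finset.sum_add_distrib]
        simp
    -- The degree sum `2|O| + 1` and the loop surplus, at most `2|O| + 4`, add up to `4|O| + 5`.
    _ ≤ (Fintype.card V + 5 * (O.card + 1)) * pairingPotential o O := by
        have hv : rootedDegree o O v ≤ 2 * O.card + 1 := by
          rw [← sum_rootedDegree o O]
          exact Finset.single_le_sum (f := rootedDegree o O) (fun _ _ => Nat.zero_le _)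
            (Finset.mem_univ v)
        have hv' : (rootedDegree o O v : ℝ) ≤ 2 * O.card + 1 := by exact_mod_cast hv
        have : (0 : ℝ) ≤ O.card := Nat.cast_nonneg _
        rw [sum_rootedDegree]
        push_cast
        refine mul_le_mul_of_nonneg_right ?_ (Nat.cast_nonneg _)
        linarith

/-- The weight 2 of a loop is harmless because a loop also has two half-edges at its vertex. -/
lemma sum_stepWeight (v : V) (O : Finset (Sym2 V)) :
    ∑ u with s(v, u) ∈ O, stepWeight v u = ∑ e ∈ O, (halfEdges v e : ℝ) := by
  have h : ∀ e : Sym2 V, ∑ u, (if s(v, u) = e then stepWeight v u else 0) = halfEdges v e := by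
    intro e
    induction e with
    | _ x y =>
      have h2 : ∀ u, (if s(v, u) = s(x, y) then stepWeight v u else 0) =
          (if u = y then if x = v then (1 : ℝ) else 0 else 0) +
            if u = x then if y = v then (1 : ℝ) else 0 else 0 := by
        intro u
        simp only [Sym2.eq_iff, stepWeight]
        by_cases h1 : x = v <;> by_cases h2 : y = v <;> by_cases h3 : u = y <;>
          by_cases h4 : u = x <;> subst_vars <;> (simp_all [eq_comm]; try norm_num)
      rw [Finset.sum_congr rfl fun u _ => h2 u, Finset.sum_add_distrib]
      simp
  rw [Finset.sum_filter, ← Finset.sum_congr rfl fun e _ => h e, Finset.sum_comm]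
  refine Finset.sum_congr rfl fun u _ => ?_
  simp

/-- Closing one of the open edges at `v`. -/
lemma sum_pairingPotential_erase_le {o v : V} {O : Finset (Sym2 V)} (h : IsParityState o v O) :
    ∑ u with s(v, u) ∈ O, stepWeight v u * (pairingPotential o (O.erase s(v, u)) : ℝ) ≤
      pairingPotential o O := by
  have h1 : ∀ u, s(v, u) ∈ O →
      (pairingPotential o O : ℝ) = rootedDegree o O v * pairingPotential o (O.erase s(v, u)) := by
    intro u hu
    have hne : s(u, v) ∉ O.erase s(v, u) := by rw [Sym2.eq_swap]; exact Finset.notMem_erase _ _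
    have := pairingPotential_insert (h.erase hu) hne
    rw [Sym2.eq_swap, Finset.insert_erase hu] at this
    exact_mod_cast this
  have hd : (0 : ℝ) < rootedDegree o O v := by
    have := h v
    rw [if_pos rfl, Nat.even_add_one] at this
    refine Nat.cast_pos.2 (Nat.pos_of_ne_zero fun h0 => this ?_)
    rw [h0]; exact Even.zero
  -- Each closing divides the potential by the degree of `v`, while the weighted number of closings
  -- is at most that degree.
  refine le_of_mul_le_mul_left ?_ hd
  rw [Finset.mul_sum]
  calc ∑ u with s(v, u) ∈ O, (rootedDegree o O v : ℝ) *
        (stepWeight v u * (pairingPotential o (O.erase s(v, u)) : ℝ))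
      = (∑ u with s(v, u) ∈ O, stepWeight v u) * pairingPotential o O := by
        rw [Finset.sum_mul]
        refine Finset.sum_congr rfl fun u hu => ?_
        rw [h1 u (Finset.mem_filter.1 hu).2]; ring
    _ ≤ (rootedDegree o O v : ℝ) * pairingPotential o O := by
        rw [sum_stepWeight]
        gcongr
        rw [rootedDegree]; push_cast; simp only [le_add_iff_nonneg_right]
        split_ifs <;> norm_num

theorem walkSum_le {o v : V} {O : Finset (Sym2 V)} (h : IsParityState o v O) (m : ℕ) :
    walkSum m v O ≤ pairingPotential o O * weightedBallot (Fintype.card V) m O.card := by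
  induction m generalizing v O with
  | zero =>
    rw [walkSum, weightedBallot]
    by_cases hO : O = ∅
    · subst hO
      simp [pairingPotential_empty]
    · rw [if_neg hO, if_neg (by simpa using hO), mul_zero]
  | succ m ih =>
    have hB := fun s => weightedBallot_nonneg (n := (Fintype.card V : ℝ)) (by positivity) m s
    have up : ∑ u with s(v, u) ∉ O, stepWeight v u * walkSum m u (toggle O s(v, u)) ≤
        pairingPotential o O * ((Fintype.card V + 5 * (O.card + 1)) *
          weightedBallot (Fintype.card V) m (O.card + 1)) := by
      calc _ ≤ ∑ u with s(v, u) ∉ O,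
            stepWeight v u * (pairingPotential o (insert s(v, u) O) : ℝ) *
              weightedBallot (Fintype.card V) m (O.card + 1) := by
            refine Finset.sum_le_sum fun u hu => ?_
            have hu' := (Finset.mem_filter.1 hu).2
            have := ih (h.toggle u)
            rw [toggle, if_neg hu', Finset.card_insert_of_notMem hu'] at this
            rw [toggle, if_neg hu', mul_assoc]
            exact mul_le_mul_of_nonneg_left this (stepWeight_nonneg _ _)
        _ ≤ _ := by
            rw [← Finset.sum_mul, ← mul_assoc]
            refine mul_le_mul_of_nonneg_right ?_ (hB _)
            rw [mul_comm (pairingPotential o O : ℝ)]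
            exact sum_pairingPotential_insert_le h
    rw [walkSum, ← Finset.sum_filter_not_add_sum_filter _ (fun u => s(v, u) ∈ O)]
    rcases hs : O.card with _ | s
    · have hO : O = ∅ := Finset.card_eq_zero.1 hs
      rw [hs] at up
      have : ∑ u with s(v, u) ∈ O, stepWeight v u * walkSum m u (toggle O s(v, u)) = 0 := by
        simp [hO]
      rw [this, add_zero, weightedBallot]
      refine up.trans_eq ?_
      push_cast; ring_nf
    · have down : ∑ u with s(v, u) ∈ O, stepWeight v u * walkSum m u (toggle O s(v, u)) ≤
          pairingPotential o O * weightedBallot (Fintype.card V) m s := by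
        calc _ ≤ ∑ u with s(v, u) ∈ O,
              stepWeight v u * (pairingPotential o (O.erase s(v, u)) : ℝ) *
                weightedBallot (Fintype.card V) m s := by
              refine Finset.sum_le_sum fun u hu => ?_
              have hu' := (Finset.mem_filter.1 hu).2
              have := ih (h.toggle u)
              rw [toggle, if_pos hu', Finset.card_erase_of_mem hu', hs, Nat.add_sub_cancel] at this
              rw [toggle, if_pos hu', mul_assoc]
              exact mul_le_mul_of_nonneg_left this (stepWeight_nonneg _ _)
          _ ≤ _ := by
              rw [← Finset.sum_mul]
              exact mul_le_mul_of_nonneg_right (sum_pairingPotential_erase_le h) (hB _)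
      rw [hs] at up
      rw [weightedBallot]
      refine (add_le_add up down).trans_eq ?_
      push_cast; ring_nf

lemma walkSum_empty_le (v : V) (m : ℕ) :
    walkSum m v ∅ ≤ weightedBallot (Fintype.card V) m 0 := by
  have h : IsParityState v v (∅ : Finset (Sym2 V)) := by
    intro a
    simp only [rootedDegree, Finset.sum_empty, zero_add]
    split_ifs <;> simp
  simpa [pairingPotential_empty] using walkSum_le h m

end StateSum

/-! ### Words as walks on states -/

section Words

variable {n : ℕ}

/-- The product of the weights of the steps of a word. -/
noncomputable def Word.weight {l : ℕ} (w : Word n l) : ℝ :=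
  ∏ j : Fin l, stepWeight (w j.castSucc) (w j.succ)

lemma Word.one_le_weight {l : ℕ} (w : Word n l) : 1 ≤ w.weight :=
  Finset.one_le_prod fun _ _ => one_le_stepWeight _ _

lemma Word.weight_cons {l : ℕ} (v : Fin n) (w : Word n l) :
    Word.weight (l := l + 1) (Fin.cons v w) = stepWeight v (w 0) * w.weight := by
  rw [Word.weight, Fin.prod_univ_succ]
  rfl

lemma Word.passages_cons {l : ℕ} (v : Fin n) (w : Word n l) (e : Sym2 (Fin n)) :
    Word.passages (l := l + 1) (Fin.cons v w) e =
      (if s(v, w 0) = e then 1 else 0) + w.passages e := by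
  rw [Word.passages, Finset.card_filter, Fin.sum_univ_succ, Word.passages, Finset.card_filter]
  rfl

/-- First-step decomposition: removing the first step toggles the parity required of its edge in the
rest of the word. -/
lemma sum_weight_eq_walkSum (l : ℕ) (v : Fin n) (O : Finset (Sym2 (Fin n))) :
    ∑ w : Fin l → Fin n,
      (if ∀ e, Even (Word.passages (l := l) (Fin.cons v w) e + if e ∈ O then 1 else 0) then
        Word.weight (l := l) (Fin.cons v w) else 0) = walkSum l v O := by
  induction l generalizing v O with
  | zero =>
    rw [Fintype.sum_unique, walkSum]
    have h : (∀ e, Even (Word.passages (l := 0)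
        (Fin.cons v (default : Fin 0 → Fin n)) e + if e ∈ O then 1 else 0)) ↔ O = ∅ := by
      simp only [Word.passages, Finset.univ_eq_empty, Finset.filter_empty, Finset.card_empty,
        zero_add, Finset.eq_empty_iff_forall_notMem]
      refine forall_congr' fun e => ?_
      split_ifs with he <;> simp [he]
    simp only [h, Word.weight, Finset.univ_eq_empty, Finset.prod_empty]
  | succ l ih =>
    rw [walkSum, ← (Fin.consEquiv fun _ => Fin n).sum_comp, Fintype.sum_prod_type]
    refine Finset.sum_congr rfl fun u _ => ?_
    rw [← ih, Finset.mul_sum]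
    refine Finset.sum_congr rfl fun w _ => ?_
    change (if ∀ e, Even (Word.passages (l := l + 1) (Fin.cons v (Fin.cons u w)) e +
      if e ∈ O then 1 else 0) then Word.weight (l := l + 1) (Fin.cons v (Fin.cons u w)) else 0) = _
    simp only [Word.weight_cons, Word.passages_cons, Fin.cons_zero, mul_ite, mul_zero]
    refine if_congr (forall_congr' fun e => ?_) rfl rfl
    by_cases he : s(v, u) = e
    · subst he
      by_cases hO : s(v, u) ∈ O
      · simp [toggle, hO, parity_simps]
      · simp [toggle, hO, add_comm]
    · have : e ∈ toggle O s(v, u) ↔ e ∈ O := by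
        rw [toggle]; split_ifs <;> simp [Ne.symm he]
      simp [he, this]

lemma Word.passages_eq_of_mem_twiceWords {k : ℕ} {w : Word n (2 * k)} (hw : w ∈ twiceWords n k)
    (e : Sym2 (Fin n)) : w.passages e = 0 ∨ w.passages e = 2 := by
  by_cases he : ∃ i, w.edge i = e
  · obtain ⟨i, rfl⟩ := he
    exact Or.inr ((Finset.mem_filter.1 hw).2 i)
  · refine Or.inl ?_
    rw [Word.passages, Finset.filter_false_of_mem fun i _ hi => he ⟨i, hi⟩, Finset.card_empty]

/-- The weighted number of words that traverse each edge an even number of times. -/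
lemma sum_twiceWords_weight_le (n k : ℕ) :
    ∑ w ∈ twiceWords n k, w.weight ≤ n * weightedBallot n (2 * k) 0 := by
  calc ∑ w ∈ twiceWords n k, w.weight
      ≤ ∑ w : Word n (2 * k), if ∀ e, Even (w.passages e + if e ∈ (∅ : Finset (Sym2 (Fin n)))
          then 1 else 0) then w.weight else 0 := by
        rw [← Finset.sum_filter]
        refine Finset.sum_le_sum_of_subset_of_nonneg (fun w hw => ?_)
          fun w _ _ => zero_le_one.trans w.one_le_weight
        refine Finset.mem_filter.2 ⟨Finset.mem_univ _, fun e => ?_⟩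
        rcases Word.passages_eq_of_mem_twiceWords hw e with h | h <;> simp [h]
    _ = ∑ v : Fin n, walkSum (2 * k) v ∅ := by
        rw [← (Fin.consEquiv fun _ => Fin n).sum_comp, Fintype.sum_prod_type]
        exact Finset.sum_congr rfl fun v _ => sum_weight_eq_walkSum _ v ∅
    _ ≤ ∑ v : Fin n, weightedBallot n (2 * k) 0 := by
        refine Finset.sum_le_sum fun v _ => ?_
        simpa using walkSum_empty_le v (2 * k)
    _ = _ := by simp

end Words

/-! ### Expectations of words -/

section Probability

variable {n : ℕ}

/-- The product of a symmetric function of the steps of a word, grouped by edges. -/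
lemma Word.prod_eq_prod_pow_passages {l : ℕ} (w : Word n l) (f : Fin n → Fin n → ℝ)
    (hf : ∀ i j, f i j = f j i) :
    ∏ j : Fin l, f (w j.castSucc) (w j.succ) =
      ∏ p : {p : Fin n × Fin n // p.1 ≤ p.2}, f p.1.1 p.1.2 ^ w.passages s(p.1.1, p.1.2) := by
  have h := Finset.prod_fiberwise' Finset.univ w.edge (Sym2.lift ⟨f, hf⟩)
  simp only [Finset.prod_const] at h
  rw [← Sym2.sortEquiv.symm.prod_comp] at h
  exact h.symm

variable {Ω : Type*} [MeasurableSpace Ω] {μ : Measure Ω}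

lemma ProbabilityTheory.iIndepFun.integrable_fun_prod [IsProbabilityMeasure μ] {ι : Type*} [Fintype ι]
    {X : ι → Ω → ℝ} (hX : iIndepFun X μ) (hm : ∀ i, Measurable (X i)) (hi : ∀ i, Integrable (X i) μ) :
    Integrable (fun ω => ∏ i, X i ω) μ := by
  have hmap := hX.map_fun_eq_pi_map fun i => (hm i).aemeasurable
  have h : Integrable (fun x : ι → ℝ => ∏ i, x i) (Measure.pi fun i => μ.map (X i)) := by
    have : ∀ i, IsProbabilityMeasure (μ.map (X i)) := fun i =>
      Measure.isProbabilityMeasure_map (hm i).aemeasurable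
    exact Integrable.fintype_prod (f := fun _ x => x) fun i =>
      (integrable_map_measure aestronglyMeasurable_id (hm i).aemeasurable).2 (hi i)
  rw [← hmap] at h
  exact h.comp_measurable (measurable_pi_lambda _ hm)

variable {x : Fin n → Fin n → Ω → ℝ} {K : ℝ}

/-- Off the diagonal this is an equality with `1/4`; on it the loop weight 2 allows variance up to
1. -/
lemma IsWigner.integral_sq_le (hx : IsWigner μ x K) (p : {p : Fin n × Fin n // p.1 ≤ p.2}) :
    ∫ ω, x p.1.1 p.1.2 ω ^ 2 ∂μ ≤ (stepWeight p.1.1 p.1.2 / 2) ^ 2 := by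
  obtain ⟨⟨i, j⟩, hij⟩ := p
  change ∫ ω, x i j ω ^ 2 ∂μ ≤ (stepWeight i j / 2) ^ 2
  rw [← variance_of_integral_eq_zero (hx.measurable i j).aemeasurable (hx.mean i j), stepWeight]
  rcases eq_or_lt_of_le hij with h | h
  · have h' : i = j := h
    subst h'
    rw [if_pos rfl]
    exact (hx.variance_diag i).trans (by norm_num)
  · rw [if_neg (ne_of_lt h), hx.variance_offDiag i j h]
    norm_num

lemma IsWigner.wordVar_eq (hx : IsWigner μ x K) {l : ℕ} (w : Word n l) :
    wordVar x w = fun ω => ∏ p : {p : Fin n × Fin n // p.1 ≤ p.2},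
      x p.1.1 p.1.2 ω ^ w.passages s(p.1.1, p.1.2) := by
  funext ω
  exact w.prod_eq_prod_pow_passages (fun i j => x i j ω) fun i j => by rw [hx.symm]

lemma IsWigner.iIndepFun_pow (hx : IsWigner μ x K)
    (c : {p : Fin n × Fin n // p.1 ≤ p.2} → ℕ) :
    iIndepFun (fun (p : {p : Fin n × Fin n // p.1 ≤ p.2}) ω => x p.1.1 p.1.2 ω ^ c p) μ :=
  hx.indep.comp (fun p y => y ^ c p) fun _ => measurable_id.pow_const _

lemma IsWigner.integrable_wordVar [IsProbabilityMeasure μ] (hx : IsWigner μ x K) {k : ℕ}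
    {w : Word n (2 * k)} (hw : w ∈ twiceWords n k) : Integrable (wordVar x w) μ := by
  rw [hx.wordVar_eq]
  refine (hx.iIndepFun_pow fun p => w.passages s(p.1.1, p.1.2)).integrable_fun_prod
    (fun p => (hx.measurable _ _).pow_const _) fun p => ?_
  rcases Word.passages_eq_of_mem_twiceWords hw s(p.1.1, p.1.2) with h | h
  · simp [h]
  · rw [h]; exact hx.integrable_pow _ _ 1

lemma IsWigner.abs_integral_wordVar_le [IsProbabilityMeasure μ] (hx : IsWigner μ x K) {k : ℕ}
    {w : Word n (2 * k)} (hw : w ∈ twiceWords n k) : |∫ ω, wordVar x w ω ∂μ| ≤ w.weight / 4 ^ k := by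
  have hwt : w.weight / 4 ^ k = ∏ p : {p : Fin n × Fin n // p.1 ≤ p.2},
      (stepWeight p.1.1 p.1.2 / 2) ^ w.passages s(p.1.1, p.1.2) := by
    rw [← w.prod_eq_prod_pow_passages (fun i j => stepWeight i j / 2)
      fun i j => by simp only [stepWeight, eq_comm], Finset.prod_div_distrib, Word.weight]
    simp [pow_mul]; norm_num
  rw [hx.wordVar_eq, hwt, (hx.iIndepFun_pow fun p =>
    w.passages s(p.1.1, p.1.2)).integral_fun_prod_eq_prod_integral
      fun p => ((hx.measurable _ _).pow_const _).aestronglyMeasurable, Finset.abs_prod]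
  refine Finset.prod_le_prod (fun _ _ => abs_nonneg _) fun p _ => ?_
  rcases Word.passages_eq_of_mem_twiceWords hw s(p.1.1, p.1.2) with h | h
  · simp [h]
  · rw [h, abs_of_nonneg (integral_nonneg fun ω => sq_nonneg _)]
    exact hx.integral_sq_le p

end Probability

/-! ### The scale `k ≈ t n^{2/3}` -/

section Asymptotics

lemma edgePower_pow_le {t : ℝ} (ht : 0 < t) (n : ℕ) :
    (edgePower t n : ℝ) ^ 3 ≤ t ^ 3 * (n : ℝ) ^ 2 := by
  have h : (edgePower t n : ℝ) ≤ t * (n : ℝ) ^ ((2 : ℝ) / 3) := Nat.floor_le (by positivity)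
  calc (edgePower t n : ℝ) ^ 3 ≤ (t * (n : ℝ) ^ ((2 : ℝ) / 3)) ^ 3 := by gcongr
    _ = t ^ 3 * (n : ℝ) ^ 2 := by
      rw [mul_pow, ← Real.rpow_natCast ((n : ℝ) ^ ((2 : ℝ) / 3)), ← Real.rpow_mul (by positivity)]
      norm_num

lemma le_edgePower_succ_pow {t : ℝ} (ht : 0 < t) (n : ℕ) :
    t ^ 3 * (n : ℝ) ^ 2 ≤ ((edgePower t n : ℝ) + 1) ^ 3 := by
  have h : t * (n : ℝ) ^ ((2 : ℝ) / 3) ≤ (edgePower t n : ℝ) + 1 := (Nat.lt_floor_add_one _).le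
  calc t ^ 3 * (n : ℝ) ^ 2 = (t * (n : ℝ) ^ ((2 : ℝ) / 3)) ^ 3 := by
        rw [mul_pow, ← Real.rpow_natCast ((n : ℝ) ^ ((2 : ℝ) / 3)),
          ← Real.rpow_mul (by positivity)]
        norm_num
    _ ≤ _ := by gcongr

/-- The Catalan number is `O(4^k k^{-3/2})` and `n = O((k + 1)^{3/2})`. Squaring avoids the
fractional powers. -/
lemma mul_ballot_le {t : ℝ} (ht : 0 < t) (n : ℕ) :
    n * ballot (2 * edgePower t n) 1 ≤ 2 / √(t ^ 3) * 4 ^ edgePower t n := by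
  have h0 := le_edgePower_succ_pow ht n
  set k := edgePower t n
  have h1 := ballot_one_le k
  have h2 := centralBinom_sq_le k
  have hk0 : (0 : ℝ) ≤ k := Nat.cast_nonneg k
  have hk : (0 : ℝ) < 2 * (k : ℝ) + 1 := by positivity
  have ht3 : 0 < t ^ 3 := by positivity
  have hb := ballot_nonneg (2 * k) (y := 1) (by norm_num)
  rw [div_mul_eq_mul_div, le_div_iff₀ (Real.sqrt_pos.2 ht3)]
  refine (sq_le_sq₀ (by positivity) (by positivity)).1 ?_
  have hk3 : ((k : ℝ) + 1) ^ 3 ≤ (2 * k + 1) ^ 3 := by gcongr; linarith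
  have hc : (2 * (k : ℝ) + 1) ^ 3 * ballot (2 * k) 1 ^ 2 ≤ 4 * 16 ^ k := by
    calc (2 * (k : ℝ) + 1) ^ 3 * ballot (2 * k) 1 ^ 2
        = (2 * (k : ℝ) + 1) * ((2 * k + 1) * ballot (2 * k) 1) ^ 2 := by ring
      _ ≤ (2 * (k : ℝ) + 1) * (2 * k.centralBinom) ^ 2 := by gcongr
      _ = 4 * ((2 * (k : ℝ) + 1) * (k.centralBinom : ℝ) ^ 2) := by ring
      _ ≤ 4 * 16 ^ k := by gcongr
  calc (n * ballot (2 * k) 1 * √(t ^ 3)) ^ 2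
      = (t ^ 3 * (n : ℝ) ^ 2) * ballot (2 * k) 1 ^ 2 := by
        rw [mul_pow, Real.sq_sqrt ht3.le]; ring
    _ ≤ (2 * (k : ℝ) + 1) ^ 3 * ballot (2 * k) 1 ^ 2 := by
        gcongr; exact h0.trans hk3
    _ ≤ 4 * 16 ^ k := hc
    _ = (2 * 4 ^ k) ^ 2 := by
        rw [mul_pow, ← pow_mul, mul_comm k 2, pow_mul]; norm_num

theorem sum_twiceWords_weight_le_const {t : ℝ} (ht : 0 < t) (n : ℕ) :
    ∑ w ∈ twiceWords n (edgePower t n), w.weight ≤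
      2 / √(t ^ 3) * Real.exp (3 + 33750 * t ^ 3) *
        ((n : ℝ) ^ edgePower t n * 4 ^ edgePower t n) := by
  refine (sum_twiceWords_weight_le n _).trans ?_
  rcases Nat.eq_zero_or_pos n with rfl | hn
  · rw [Nat.cast_zero, zero_mul]; positivity
  have hpow := edgePower_pow_le ht n
  have hmul := mul_ballot_le ht n
  set k := edgePower t n
  have hn1 : (1 : ℝ) ≤ n := by exact_mod_cast hn
  have hr : 1 ≤ √(n : ℝ) := Real.one_le_sqrt.2 hn1
  have hr2 : √(n : ℝ) ^ 2 = n := Real.sq_sqrt (by positivity)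
  have h := weightedBallot_le (t := t) (k := k) hr (by rwa [hr2]) (2 * k) 0 le_rfl
  rw [hr2, pow_zero, one_mul, pow_mul, hr2] at h
  have hexp : 1 / (150 * (k : ℝ) ^ 2) * (2 * k : ℕ) * (((0 : ℕ) : ℝ) + 1) ^ 2 +
      (1 + 16875 * t ^ 3) / k * (2 * k : ℕ) ≤ 3 + 33750 * t ^ 3 := by
    -- For `k = 0` the exponent is 0, division by zero being 0.
    rcases Nat.eq_zero_or_pos k with hk | hk
    · rw [hk]; simp; positivity
    · have hk1 : (1 : ℝ) ≤ k := by exact_mod_cast hk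
      have e : 1 / (150 * (k : ℝ) ^ 2) * (2 * k : ℕ) * (((0 : ℕ) : ℝ) + 1) ^ 2 +
          (1 + 16875 * t ^ 3) / k * (2 * k : ℕ) = 1 / (75 * k) + 2 + 33750 * t ^ 3 := by
        push_cast; field_simp; ring
      have : 1 / (75 * (k : ℝ)) ≤ 1 := by
        rw [div_le_one (by positivity)]; linarith
      rw [e]; linarith
  have hb := ballot_nonneg (2 * k) (y := 1) (by norm_num)
  calc (n : ℝ) * weightedBallot n (2 * k) 0
      ≤ n * ((n : ℝ) ^ k * (ballot (2 * k) 1 * Real.exp (3 + 33750 * t ^ 3))) := by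
        gcongr
        refine h.trans ?_
        rw [Nat.cast_zero, zero_add]
        gcongr
    _ = (n * ballot (2 * k) 1) * ((n : ℝ) ^ k * Real.exp (3 + 33750 * t ^ 3)) := by ring
    _ ≤ (2 / √(t ^ 3) * 4 ^ k) * ((n : ℝ) ^ k * Real.exp (3 + 33750 * t ^ 3)) := by gcongr
    _ = _ := by ring

end Asymptotics

theorem proposition2 (t : ℝ) (ht : 0 < t) :
    ∃ C : ℝ,
      (∀ (n : ℕ) {Ω : Type*} [MeasurableSpace Ω] (μ : Measure Ω) [IsProbabilityMeasure μ]
          (x : Fin n → Fin n → Ω → ℝ) (K : ℝ), IsWigner μ x K →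
        (∀ w ∈ twiceWords n (edgePower t n), Integrable (wordVar x w) μ) ∧
        |((n : ℝ) ^ edgePower t n)⁻¹ *
            ∑ w ∈ twiceWords n (edgePower t n), ∫ ω, wordVar x w ω ∂μ| ≤ C) ∧
      ∀ n : ℕ, ((twiceWords n (edgePower t n)).card : ℝ) ≤
        C * ((n : ℝ) ^ edgePower t n * 2 ^ (2 * edgePower t n)) := by
  refine ⟨2 / √(t ^ 3) * Real.exp (3 + 33750 * t ^ 3), ?_, fun n => ?_⟩
  · intro n Ω _ μ _ x K hx
    refine ⟨fun w hw => hx.integrable_wordVar hw, ?_⟩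
    have hsum := sum_twiceWords_weight_le_const ht n
    set k := edgePower t n
    set C := 2 / √(t ^ 3) * Real.exp (3 + 33750 * t ^ 3)
    have hC : 0 ≤ C := by positivity
    have h4 : (0 : ℝ) < 4 ^ k := by positivity
    have h1 : |∑ w ∈ twiceWords n k, ∫ ω, wordVar x w ω ∂μ| ≤ C * (n : ℝ) ^ k := by
      calc |∑ w ∈ twiceWords n k, ∫ ω, wordVar x w ω ∂μ|
          ≤ ∑ w ∈ twiceWords n k, |∫ ω, wordVar x w ω ∂μ| := Finset.abs_sum_le_sum_abs _ _
        _ ≤ ∑ w ∈ twiceWords n k, w.weight / 4 ^ k :=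
            Finset.sum_le_sum fun w hw => hx.abs_integral_wordVar_le hw
        _ ≤ C * (n : ℝ) ^ k := by
            rw [← Finset.sum_div, div_le_iff₀ h4]
            linarith
    rw [abs_mul, abs_of_nonneg (by positivity : (0 : ℝ) ≤ ((n : ℝ) ^ k)⁻¹)]
    calc ((n : ℝ) ^ k)⁻¹ * |∑ w ∈ twiceWords n k, ∫ ω, wordVar x w ω ∂μ|
        ≤ ((n : ℝ) ^ k)⁻¹ * (C * (n : ℝ) ^ k) := by gcongr
      _ = C * (((n : ℝ) ^ k)⁻¹ * (n : ℝ) ^ k) := by ring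
      _ ≤ C * 1 := by gcongr; exact inv_mul_le_one
      _ = C := mul_one C
  · calc ((twiceWords n (edgePower t n)).card : ℝ)
        = ∑ w ∈ twiceWords n (edgePower t n), (1 : ℝ) := by simp
      _ ≤ ∑ w ∈ twiceWords n (edgePower t n), w.weight :=
          Finset.sum_le_sum fun w _ => w.one_le_weight
      _ ≤ _ := by
          rw [pow_mul, show (2 : ℝ) ^ 2 = 4 by norm_num]
          exact sum_twiceWords_weight_le_const ht n
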